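/- For integers $n\ge 3$ and $k\ge 0$, the crown $S_n^k$ is the poset with ground set $\{a_1,\dots,a_{n+k}\}\cup\{b_1,\dots,b_{n+k}\}$, indices read cyclically modulo $n+k$, whose only strict relations are $a_i<b_j$ for $j\notin\{i,i+1,\dots,i+k\}$. In a poset $P$, a critical pair is an ordered pair $(x,y)$ of incomparable elements such that $z<x$ implies $z<y$, and $w>y$ implies $w>x$. A set $R$ of critical pairs is reversible if there is a linear extension $L$ of $P$ with $x>y$ in $L$ for all $(x,y)\in R$. The graph of critical pairs of $P$ has the critical pairs as vertices, and two distinct critical pairs $p,q$ are adjacent when $\{p,q\}$ is not reversible but each of its proper subsets is. Let $G_n^k$ be the graph of critical pairs of $S_n^k$. Theorem. Let $n,k$ be integers with $3\le n\le k$. If $S$ is an independent set in $G_n^k$ that is not reversible, then \[|S|\le \frac{(k+1)(k+2)}{2}+2-n .\] Moreover, for every such $n,k$ this bound is attained: there is an independent, non-reversible set $S$ in $G_n^k$ with $|S|=\frac{(k+1)(k+2)}{2}+2-n$. -/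

import Mathlib

section GeneralPosets

variable (P : Type*) [PartialOrder P]

/-- The critical pairs of a poset: incomparable pairs `(x, y)` such that `z < x` implies `z < y`
and `y < w` implies `x < w`. -/
def Crit : Set (P × P) :=
  {p | IncompRel (· ≤ ·) p.1 p.2 ∧ (∀ z, z < p.1 → z < p.2) ∧ (∀ w, p.2 < w → p.1 < w)}

variable {P}

/-- A set `R` of pairs is reversible when some linear extension `L` of `P` has `x > y` in `L` for
all `(x, y) ∈ R`. -/
def Reversible (R : Set (P × P)) : Prop :=
  ∃ L : P → P → Prop, IsLinearOrder P L ∧ (∀ x y, x ≤ y → L x y) ∧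
    ∀ p ∈ R, L p.2 p.1 ∧ p.2 ≠ p.1

/-- A set of critical pairs is reversible when its underlying set of pairs is. -/
def CritReversible (S : Set (Crit P)) : Prop :=
  Reversible (Subtype.val '' S)

/-- The edges of the hypergraph of critical pairs: the sets of critical pairs that are not
reversible although every proper subset is. -/
def IsCritHyperedge (E : Set (Crit P)) : Prop :=
  ¬ CritReversible E ∧ ∀ F : Set (Crit P), F ⊂ E → CritReversible F

variable (P)

/-- The graph of critical pairs: its edges are the edges of size two of the hypergraph of
critical pairs. -/
def critGraph : SimpleGraph (Crit P) where
  Adj p q := p ≠ q ∧ IsCritHyperedge {p, q}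
  symm := ⟨fun p q h => ⟨h.1.symm, by rw [Set.pair_comm]; exact h.2⟩⟩
  loopless := ⟨fun _ h => h.1 rfl⟩

end GeneralPosets

/-- The ground set of the crown `S_n^k`: minimal elements `a i` and maximal elements `b j`, with
indices read cyclically modulo `n + k`. -/
inductive Crown (n k : ℕ) : Type
  | a (i : ZMod (n + k)) : Crown n k
  | b (j : ZMod (n + k)) : Crown n k

namespace Crown

/-- The order of the crown `S_n^k`: `a i < b j` exactly when `j` is not in the cyclic interval
`{i, i + 1, …, i + k}`, and there are no other strict relations. -/
inductive Le (n k : ℕ) : Crown n k → Crown n k → Prop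
  | refl (x : Crown n k) : Le n k x x
  | ab (i j : ZMod (n + k)) (h : ∀ t : ℕ, t ≤ k → j ≠ i + (t : ZMod (n + k))) :
      Le n k (a i) (b j)

instance (n k : ℕ) : PartialOrder (Crown n k) where
  le := Le n k
  le_refl := Le.refl
  le_trans x y z h₁ h₂ := by
    cases h₁ with
    | refl => exact h₂
    | ab i j h => cases h₂ with
      | refl => exact Le.ab i j h
  le_antisymm x y h₁ h₂ := by
    cases h₁ with
    | refl => rfl
    | ab i j h => cases h₂

end Crown

/-!
A set of critical pairs is reversible if and only if it has no alternating cycle, and it is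
independent if and only if it has no alternating `2`-cycle. A critical pair of the crown has the
form `(a i, b j)`, so a set `S` of them is a family of rows `J i = {j | (a i, b j) ∈ S}`. Let `B i`
be the set of all `x` such that `a x` lies below some `b j` with `j ∈ J i`; these are the rows that
row `i` forces to come before it in a reversing linear order.

* `B i` arises from a translate of `J i` by `n - 2` steps of adding the successor of every point, so
  `#(J i) + (n - 2) * c ≤ #(B i)` where `c` is the number of arcs of `B i`.
* Independence says that `x ∈ B i` excludes `i ∈ B x`, so the `s` nonempty rows meet the sets `B i`
  in at most `s * (s - 1) / 2` pairs; the other `n + k - s` points contribute at most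
  `s * (n + k - s)`.

Together these give `#S ≤ (k + 1) * (k + 2) / 2`, reached by reversible sets. If `S` is not
reversible, then either some `B i` has two arcs, which gains `n - 2` in the first estimate, or every
`B i` is a single arc. In that case no point lies in all of the arcs, because cutting the cycle at
such a point would turn the alternating cycle into an alternating `2`-cycle, and this gains
`n + k - s` in the second estimate.
-/

theorem wellFoundedOn_pair_iff {α : Type*} {r : α → α → Prop} {x y : α} (hx : ¬ r x x)
    (hy : ¬ r y y) : ({x, y} : Set α).WellFoundedOn r ↔ ¬ (r x y ∧ r y x) := by
  refine ⟨fun h hxy => ?_, fun h => ?_⟩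
  · exact h.asymmetric (a := ⟨x, by simp⟩) (b := ⟨y, by simp⟩) hxy.1 hxy.2
  · rw [Set.wellFoundedOn_iff]
    wlog hyx : ¬ r y x generalizing x y
    · rw [Set.pair_comm]
      exact this hy hx (fun h' => h h'.symm) fun hxy => h ⟨hxy, not_not.1 hyx⟩
    have acc_x : Acc (fun a b => r a b ∧ a ∈ ({x, y} : Set α) ∧ b ∈ ({x, y} : Set α)) x := by
      refine .intro x ?_
      rintro w ⟨hwx, rfl | rfl, -⟩
      · exact absurd hwx hx
      · exact absurd hwx hyx
    refine ⟨fun z => .intro z ?_⟩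
    rintro w ⟨hwz, rfl | rfl, hz⟩
    · exact acc_x
    · obtain rfl | rfl := hz
      · exact absurd hwz hyx
      · exact absurd hwz hy

section CriticalPairs

variable {P : Type*} [PartialOrder P]

/-- The relation between pairs whose cycles are the alternating cycles of the poset: a linear
extension reversing `p` and `q` has `p.1 ≤ q.2 < q.1`, so it puts `p.1` below `q.1`. -/
def Precedes (p q : P × P) : Prop :=
  p.1 ≤ q.2

theorem reversible_of_wellFoundedOn [WellFoundedLT P] {R : Set (P × P)}
    (hR : R.WellFoundedOn Precedes) : Reversible R := by
  classical
  let E : P → P → Prop := fun x y => x < y ∨ (y, x) ∈ R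
  have acc_of_le : ∀ p ∈ R, ∀ w ≤ p.2, Acc E w := fun p hp =>
    hR.induction (P := fun p => ∀ w ≤ p.2, Acc E w) hp fun p _ ih =>
      WellFoundedLT.fix fun w ihw hw => .intro w fun v hv => hv.elim
        (fun hvw => ihw v hvw (hvw.le.trans hw)) (fun hwv => ih (w, v) hwv hw v le_rfl)
  have acc_E : ∀ y, Acc E y := WellFoundedLT.fix fun y ih =>
    .intro y fun x hx => hx.elim (ih x) fun h => acc_of_le _ h x le_rfl
  have : IsWellFounded P E := ⟨⟨acc_E⟩⟩
  obtain ⟨s, hEs, hs⟩ := IsWellFounded.exists_well_order_ge E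
  let L := linearOrderOfSTO s
  refine ⟨L.le, (inferInstance : @IsLinearOrder P (@LE.le P L.toLE)), fun x y hxy => ?_,
    fun p hp => ⟨.inr (hEs _ _ (.inr hp)), ne_of_irrefl (hEs _ _ (.inr hp))⟩⟩
  exact hxy.eq_or_lt.imp_right fun hlt => hEs _ _ (.inl hlt)

theorem wellFoundedOn_of_reversible [Finite P] {R : Set (P × P)} (hR : Reversible R) :
    R.WellFoundedOn Precedes := by
  obtain ⟨L, hL, hle, hrev⟩ := hR
  let ltL : P → P → Prop := fun x y => L x y ∧ x ≠ y
  have wellFounded_ltL : WellFounded ltL :=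
    have : IsTrans P ltL := ⟨fun x y z hxy hyz => ⟨hL.trans _ _ _ hxy.1 hyz.1, fun h =>
      hxy.2 (hL.antisymm _ _ hxy.1 (h ▸ hyz.1))⟩⟩
    have : Std.Irrefl ltL := ⟨fun _ h => h.2 rfl⟩
    Finite.wellFounded_of_trans_of_irrefl ltL
  refine Subrelation.wf (fun {p q} hpq => ?_) (InvImage.wf (fun p : R => p.1.1) wellFounded_ltL)
  have hpq' : L p.1.1 q.1.2 := hle _ _ hpq
  obtain ⟨hq, hq_ne⟩ := hrev q q.2
  refine ⟨hL.trans _ _ _ hpq' hq, fun (h : p.1.1 = q.1.1) => hq_ne (hL.antisymm _ _ hq ?_)⟩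
  rwa [← h]

/-- Trotter's criterion: on a finite poset, reversibility is the absence of alternating cycles. -/
theorem reversible_iff_wellFoundedOn [Finite P] {R : Set (P × P)} :
    Reversible R ↔ R.WellFoundedOn Precedes :=
  ⟨wellFoundedOn_of_reversible, reversible_of_wellFoundedOn⟩

theorem critReversible_iff_wellFoundedOn [Finite P] {S : Set (Crit P)} :
    CritReversible S ↔ S.WellFoundedOn fun p q => Precedes p.1 q.1 :=
  reversible_iff_wellFoundedOn.trans Set.wellFoundedOn_image

theorem not_precedes_self (p : Crit P) : ¬ Precedes p.1 p.1 :=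
  p.2.1.1

theorem critReversible_pair_iff [Finite P] {p q : Crit P} :
    CritReversible {p, q} ↔ ¬ (Precedes p.1 q.1 ∧ Precedes q.1 p.1) :=
  critReversible_iff_wellFoundedOn.trans
    (wellFoundedOn_pair_iff (not_precedes_self p) (not_precedes_self q))

theorem critGraph_adj_iff [Finite P] {p q : Crit P} :
    (critGraph P).Adj p q ↔ Precedes p.1 q.1 ∧ Precedes q.1 p.1 := by
  have critReversible_singleton (r : Crit P) : CritReversible {r} := by
    rw [← Set.pair_eq_singleton, critReversible_pair_iff]
    exact fun h => not_precedes_self r h.1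
  refine ⟨fun h => not_not.1 (critReversible_pair_iff.not.1 h.2.1), fun h => ⟨?_, ?_, ?_⟩⟩
  · rintro rfl
    exact not_precedes_self p h.1
  · exact critReversible_pair_iff.not.2 (not_not.2 h)
  · intro F hF
    obtain rfl | rfl | rfl | rfl := Set.subset_pair_iff_eq.1 hF.1
    · exact critReversible_iff_wellFoundedOn.2 (Set.wellFoundedOn_empty _)
    · exact critReversible_singleton p
    · exact critReversible_singleton q
    · exact absurd hF (ssubset_irrefl _)

theorem isIndepSet_critGraph_iff [Finite P] {S : Set (Crit P)} :
    (critGraph P).IsIndepSet S ↔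
      ∀ p ∈ S, ∀ q ∈ S, Precedes p.1 q.1 → ¬ Precedes q.1 p.1 := by
  refine ⟨fun h p hp q hq hpq hqp => ?_, fun h p hp q hq _ hadj => ?_⟩
  · have hadj := critGraph_adj_iff.2 ⟨hpq, hqp⟩
    exact h hp hq hadj.ne hadj
  · obtain ⟨hpq, hqp⟩ := critGraph_adj_iff.1 hadj
    exact h p hp q hq hpq hqp

end CriticalPairs

section Counting

open Finset Function

variable {α : Type*}

/-- A vertex has in-degree plus out-degree at most `#A - 1`, and both sums count the arcs. -/
theorem two_mul_sum_card_filter_add_card_le (A : Finset α) {r : α → α → Prop} [DecidableRel r]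
    (hr : ∀ x y, r x y → ¬ r y x) :
    2 * ∑ y ∈ A, #{x ∈ A | r x y} + #A ≤ #A * #A := by
  have card_in_add_card_out_lt (y) (hy : y ∈ A) :
      #{x ∈ A | r x y} + #{x ∈ A | r y x} + 1 ≤ #A := by
    classical
    rw [← card_union_of_disjoint (disjoint_filter.2 fun x _ => hr x y), ← filter_or]
    exact card_lt_card (filter_ssubset.2 ⟨y, hy, fun h => h.elim (fun h => hr y y h h)
      fun h => hr y y h h⟩)
  have sum_in_eq_sum_out : ∑ y ∈ A, #{x ∈ A | r x y} = ∑ y ∈ A, #{x ∈ A | r y x} :=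
    (sum_card_bipartiteAbove_eq_sum_card_bipartiteBelow r).symm
  calc 2 * ∑ y ∈ A, #{x ∈ A | r x y} + #A
      = ∑ y ∈ A, (#{x ∈ A | r x y} + #{x ∈ A | r y x} + 1) := by
        rw [sum_add_distrib, sum_add_distrib, ← sum_in_eq_sum_out, card_eq_sum_ones, two_mul]
    _ ≤ #A * #A := sum_le_card_nsmul _ _ _ card_in_add_card_out_lt

variable [DecidableEq α]

theorem two_mul_sum_card_add_card_le (A : Finset α) {B : α → Finset α}
    (hasymm : ∀ x y, x ∈ B y → y ∉ B x) :
    2 * ∑ y ∈ A, #(B y) + #A ≤ #A * #A + 2 * ∑ y ∈ A, #(B y \ A) := by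
  have card_eq (y) : #(B y) = #{x ∈ A | x ∈ B y} + #(B y \ A) := by
    rw [filter_mem_eq_inter, inter_comm, add_comm, card_sdiff_add_card_inter]
  have := two_mul_sum_card_filter_add_card_le A hasymm
  rw [sum_congr rfl fun y _ => card_eq y, sum_add_distrib]
  lia

theorem sum_card_sdiff_le [Fintype α] (A : Finset α) (B : α → Finset α) :
    ∑ y ∈ A, #(B y \ A) ≤ #A * #Aᶜ :=
  sum_le_card_nsmul _ _ _ fun _ _ => card_le_card (sdiff_subset_sdiff (subset_univ _) le_rfl)

theorem sum_card_sdiff_add_card_compl_le [Fintype α] {A : Finset α} {B : α → Finset α}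
    (h : ∀ z ∉ A, ∃ y ∈ A, z ∉ B y) : ∑ y ∈ A, #(B y \ A) + #Aᶜ ≤ #A * #Aᶜ := by
  have card_filter_lt (z) (hz : z ∈ Aᶜ) : #{y ∈ A | z ∈ B y} + 1 ≤ #A :=
    card_lt_card (filter_ssubset.2 (h z (mem_compl.1 hz)))
  have sdiff_eq (y) : B y \ A = {z ∈ Aᶜ | z ∈ B y} := by
    ext z
    simp only [mem_sdiff, mem_filter, mem_compl, and_comm]
  calc ∑ y ∈ A, #(B y \ A) + #Aᶜ = ∑ z ∈ Aᶜ, (#{y ∈ A | z ∈ B y} + 1) := by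
        simp only [sdiff_eq, sum_add_distrib, ← card_eq_sum_ones]
        exact congrArg (· + #Aᶜ) (sum_card_bipartiteAbove_eq_sum_card_bipartiteBelow _)
    _ ≤ #A * #Aᶜ := (sum_le_card_nsmul _ _ _ card_filter_lt).trans_eq (mul_comm _ _)

variable (f : α → α)

/-- A set together with its image under `f`; for the successor map on a cycle, this extends each
arc of the set by one point. -/
def thicken (B : Finset α) : Finset α :=
  B ∪ B.image f

/-- The points of a set that `f` maps out of the set; for the successor map on a cycle, these are
the last points of its arcs. -/
def exits (B : Finset α) : Finset α :=
  {x ∈ B | f x ∉ B}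

variable {f}

theorem mem_exits {B : Finset α} {x : α} : x ∈ exits f B ↔ x ∈ B ∧ f x ∉ B :=
  mem_filter

theorem mem_iterate_thicken {B : Finset α} {x : α} {m : ℕ} :
    x ∈ (thicken f)^[m] B ↔ ∃ t ≤ m, ∃ y ∈ B, f^[t] y = x := by
  induction m generalizing B with
  | zero => simp
  | succ m ih =>
    rw [iterate_succ_apply, ih]
    constructor
    · rintro ⟨t, ht, y, hy, rfl⟩
      obtain hy | hy := mem_union.1 hy
      · exact ⟨t, by omega, y, hy, rfl⟩
      · obtain ⟨z, hz, rfl⟩ := mem_image.1 hy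
        exact ⟨t + 1, by omega, z, hz, rfl⟩
    · rintro ⟨t, ht, y, hy, rfl⟩
      cases t with
      | zero => exact ⟨0, by omega, y, mem_union_left _ hy, rfl⟩
      | succ t => exact ⟨t, by omega, f y, mem_union_right _ (mem_image_of_mem f hy), rfl⟩

theorem card_thicken (hf : Injective f) (B : Finset α) :
    #(thicken f B) = #B + #(exits f B) := by
  have thicken_eq : thicken f B = B ∪ (exits f B).image f := by
    ext x
    simp only [thicken, exits, mem_union, mem_image, mem_filter]
    grind
  rw [thicken_eq, card_union_of_disjoint, card_image_of_injective _ hf]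
  rw [disjoint_right]
  rintro _ hx
  obtain ⟨y, hy, rfl⟩ := mem_image.1 hx
  exact (mem_exits.1 hy).2

theorem exits_thicken_subset (B : Finset α) :
    exits f (thicken f B) ⊆ (exits f B).image f := by
  intro x hx
  simp only [exits, thicken, mem_filter, mem_union, mem_image] at hx ⊢
  grind

theorem card_exits_thicken_le (B : Finset α) : #(exits f (thicken f B)) ≤ #(exits f B) :=
  (card_le_card (exits_thicken_subset B)).trans card_image_le

/-- Thickening only merges arcs, so each of the `m` steps adds at least as many points as there are
arcs at the end. -/
theorem card_add_mul_card_exits_le (hf : Injective f) (B : Finset α) (m : ℕ) :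
    #B + m * #(exits f ((thicken f)^[m] B)) ≤ #((thicken f)^[m] B) := by
  induction m with
  | zero => simp
  | succ m ih =>
    rw [iterate_succ_apply', card_thicken hf]
    have := card_exits_thicken_le (f := f) ((thicken f)^[m] B)
    nlinarith

theorem exists_iterate_mem_exits {B : Finset α} {z : α} {s t : ℕ} (hst : s ≤ t)
    (hs : f^[s] z ∈ B) (ht : f^[t] z ∉ B) : ∃ r, s ≤ r ∧ r < t ∧ f^[r] z ∈ exits f B := by
  induction t, hst using Nat.le_induction with
  | base => exact absurd hs ht
  | succ t hst ih =>
    by_cases htB : f^[t] z ∈ B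
    · exact ⟨t, hst, t.lt_succ_self, mem_exits.2 ⟨htB, by rwa [← iterate_succ_apply' f]⟩⟩
    · obtain ⟨r, hsr, hrt, hr⟩ := ih htB
      exact ⟨r, hsr, hrt.trans t.lt_succ_self, hr⟩

end Counting

section Cyclic

open Finset Function

variable {N : ℕ}

theorem iterate_add_one (x : ZMod N) (t : ℕ) : (· + 1)^[t] x = x + t := by
  simp [add_right_iterate]

variable [NeZero N]

theorem add_natCast_val_sub (z x : ZMod N) : z + ((x - z).val : ZMod N) = x := by
  simp

theorem exists_mem_exits_of_val_sub_le {B : Finset (ZMod N)} {z x p : ZMod N} (hx : x ∈ B)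
    (hp : p ∉ B) (hxp : (x - z).val ≤ (p - z).val) :
    ∃ e ∈ exits (· + 1) B, (x - z).val ≤ (e - z).val ∧ (e - z).val < (p - z).val := by
  obtain ⟨r, hxr, hrp, hr⟩ := exists_iterate_mem_exits (f := (· + 1)) (z := z) (B := B) hxp
    (by rwa [iterate_add_one, add_natCast_val_sub]) (by rwa [iterate_add_one, add_natCast_val_sub])
  rw [iterate_add_one] at hr
  refine ⟨_, hr, ?_⟩
  rw [add_sub_cancel_left, ZMod.val_cast_of_lt (hrp.trans (ZMod.val_lt _))]
  exact ⟨hxr, hrp⟩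

theorem one_lt_card_exits {B : Finset (ZMod N)} {z p x q : ZMod N} (hz : z ∈ B) (hp : p ∉ B)
    (hx : x ∈ B) (hq : q ∉ B) (hpx : (p - z).val ≤ (x - z).val)
    (hxq : (x - z).val ≤ (q - z).val) : 1 < #(exits (· + 1) B) := by
  obtain ⟨e, he, -, hep⟩ := exists_mem_exits_of_val_sub_le (z := z) hz hp (by simp)
  obtain ⟨e', he', hxe', -⟩ := exists_mem_exits_of_val_sub_le hx hq hxq
  refine one_lt_card.2 ⟨e, he, e', he', ?_⟩
  rintro rfl
  exact absurd (hpx.trans hxe') hep.not_ge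

theorem exits_nonempty {B : Finset (ZMod N)} (hB : B.Nonempty) {p : ZMod N} (hp : p ∉ B) :
    (exits (· + 1) B).Nonempty := by
  obtain ⟨x, hx⟩ := hB
  obtain ⟨e, he, -⟩ := exists_mem_exits_of_val_sub_le (z := x) hx hp (by simp)
  exact ⟨e, he⟩

/-- Seen from a point `z` lying in every arc, an arc that meets `C` contains one of the two extreme
points `p` and `q` of `C`; this forces both `q ∈ B p` and `p ∈ B q`. -/
theorem exists_notMem_of_card_exits_le_one {C : Finset (ZMod N)} (hC : C.Nonempty)
    {B : ZMod N → Finset (ZMod N)} (harc : ∀ i ∈ C, #(exits (· + 1) (B i)) ≤ 1)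
    (hasymm : ∀ x i, x ∈ B i → i ∉ B x) (hcyc : ∀ i ∈ C, ∃ x ∈ C, x ∈ B i) (z : ZMod N) :
    ∃ i ∈ C, z ∉ B i := by
  by_contra! hz
  have not_self (i) : i ∉ B i := fun h => hasymm i i h h
  obtain ⟨p, hpC, hp⟩ := C.exists_min_image (fun x => (x - z).val) hC
  obtain ⟨q, hqC, hq⟩ := C.exists_max_image (fun x => (x - z).val) hC
  have mem_or_mem {i} (hiC : i ∈ C) : p ∈ B i ∨ q ∈ B i := by
    by_contra! h
    obtain ⟨x, hxC, hx⟩ := hcyc i hiC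
    exact (one_lt_card_exits (hz i hiC) h.1 hx h.2 (hp x hxC) (hq x hxC)).not_ge (harc i hiC)
  have hqp : q ∈ B p := (mem_or_mem hpC).resolve_left (not_self p)
  exact hasymm q p hqp ((mem_or_mem hqC).resolve_right (not_self q))

end Cyclic

namespace Crown

open Finset Function

variable {n k : ℕ}

instance [NeZero (n + k)] : Finite (Crown n k) :=
  .of_surjective (Sum.elim a b) <| by
    rintro (i | j)
    exacts [⟨.inl i, rfl⟩, ⟨.inr j, rfl⟩]

theorem a_le_b_iff {i j : ZMod (n + k)} :
    (a i : Crown n k) ≤ b j ↔ ∀ t : ℕ, t ≤ k → j ≠ i + t := by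
  refine ⟨fun h => ?_, Le.ab i j⟩
  cases h with
  | ab _ _ h => exact h

theorem not_a_le_b_iff {i j : ZMod (n + k)} :
    ¬ (a i : Crown n k) ≤ b j ↔ ∃ t ≤ k, j = i + t := by
  simp [a_le_b_iff]

theorem not_lt_a (x : Crown n k) (i : ZMod (n + k)) : ¬ x < a i := by
  intro h
  cases h.le with
  | refl => exact lt_irrefl _ h

theorem not_b_lt (x : Crown n k) (j : ZMod (n + k)) : ¬ b j < x := by
  intro h
  cases h.le with
  | refl => exact lt_irrefl _ h

theorem a_lt_b_iff {i j : ZMod (n + k)} : (a i : Crown n k) < b j ↔ a i ≤ b j :=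
  ⟨le_of_lt, fun h => h.lt_of_ne nofun⟩

theorem add_natCast_ne_self (x : ZMod (n + k)) {s : ℕ} (h0 : s ≠ 0) (hs : s < n + k) :
    x + s ≠ x := by
  rw [Ne, add_eq_left, ZMod.natCast_eq_zero_iff]
  exact Nat.not_dvd_of_pos_of_lt (Nat.pos_of_ne_zero h0) hs

theorem a_le_b_iff_exists (hn : 2 ≤ n) {x j : ZMod (n + k)} :
    (a x : Crown n k) ≤ b j ↔ ∃ t ≤ n - 2, j + 1 + t = x := by
  have : NeZero (n + k) := ⟨by omega⟩
  constructor
  · intro h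
    have hx : j + 1 + ((x - (j + 1)).val : ZMod (n + k)) = x := add_natCast_val_sub _ _
    have hlt := (x - (j + 1)).val_lt
    generalize (x - (j + 1)).val = s at hx hlt
    refine ⟨s, ?_, hx⟩
    by_contra! hs
    refine a_le_b_iff.1 h (n + k - 1 - s) (by omega) ?_
    have hN : ((1 + s + (n + k - 1 - s) : ℕ) : ZMod (n + k)) = 0 := by
      rw [show 1 + s + (n + k - 1 - s) = n + k by omega, ZMod.natCast_self]
    push_cast at hN
    linear_combination -hN + hx
  · rintro ⟨t, ht, rfl⟩
    refine a_le_b_iff.2 fun s hs h => ?_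
    refine add_natCast_ne_self j (s := 1 + t + s) (by omega) (by omega) ?_
    push_cast
    linear_combination -h

theorem natCast_a_le_b_iff {i j : ℕ} (hi : i < n + k) (hj : j < n + k) :
    (a i : Crown n k) ≤ b j ↔ (j < i ∧ i < j + n) ∨ i + k < j := by
  rw [← not_iff_not, not_a_le_b_iff]
  constructor
  · rintro ⟨t, ht, h⟩
    rw [← Nat.cast_add, ZMod.natCast_eq_natCast_iff', Nat.mod_eq_of_lt hj] at h
    obtain hlt | hge := lt_or_ge (i + t) (n + k)
    · rw [Nat.mod_eq_of_lt hlt] at h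
      omega
    · rw [Nat.mod_eq_sub_mod hge, Nat.mod_eq_of_lt (by omega)] at h
      omega
  · intro h
    obtain hij | hji := le_or_gt i j
    · exact ⟨j - i, by omega, by rw [Nat.cast_sub hij, add_sub_cancel]⟩
    · refine ⟨j + (n + k) - i, by omega, ?_⟩
      rw [Nat.cast_sub (by omega), Nat.cast_add j, ZMod.natCast_self, add_zero, add_sub_cancel]

theorem mem_crit_of_not_le {i j : ZMod (n + k)} (h : ¬ (a i : Crown n k) ≤ b j) :
    ((a i, b j) : Crown n k × Crown n k) ∈ Crit (Crown n k) :=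
  ⟨⟨h, fun hle => not_b_lt _ _ (hle.lt_of_ne nofun)⟩, fun z hz => absurd hz (not_lt_a z i),
    fun w hw => absurd hw (not_b_lt w j)⟩

/-- If `x ≠ y`, the interval `{x, …, x + k}` contains `y + k + 1`, the point just after
`{y, …, y + k}`. -/
theorem eq_of_forall_exists_add_eq (hn : 2 ≤ n) {x y : ZMod (n + k)}
    (h : ∀ t : ℕ, t ≤ k → ∃ s : ℕ, s ≤ k ∧ x + t = y + s) : x = y := by
  obtain ⟨s, hs, hxy⟩ := h 0 k.zero_le
  rw [Nat.cast_zero, add_zero] at hxy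
  by_contra hne
  have hs0 : s ≠ 0 := by
    rintro rfl
    exact hne (by simpa using hxy)
  obtain ⟨r, hr, hyr⟩ := h (k + 1 - s) (by omega)
  refine add_natCast_ne_self (y + (r : ZMod (n + k))) (s := k + 1 - r) (by omega) (by omega) ?_
  rw [Nat.cast_sub (by omega)] at hyr ⊢
  linear_combination hyr - hxy

theorem exists_eq_of_mem_crit (hn : 2 ≤ n) {p : Crown n k × Crown n k}
    (hp : p ∈ Crit (Crown n k)) : ∃ i j, p = (a i, b j) := by
  obtain ⟨x, y⟩ := p
  obtain ⟨⟨hxy, -⟩, hdown, hup⟩ := hp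
  have hne : x ≠ y := fun h => hxy h.le
  cases x with
  | a i =>
    cases y with
    | b j => exact ⟨i, j, rfl⟩
    | a j =>
      refine absurd (congrArg a (eq_of_forall_exists_add_eq hn fun t ht => ?_)) hne
      refine not_a_le_b_iff.1 fun h => ?_
      exact not_a_le_b_iff.2 ⟨t, ht, rfl⟩ (a_lt_b_iff.1 (hup _ (a_lt_b_iff.2 h)))
  | b i =>
    cases y with
    | a j =>
      have a_lt_b : (a (i + 1) : Crown n k) < b i := by
        refine a_lt_b_iff.2 (a_le_b_iff.2 fun t ht h => ?_)
        refine add_natCast_ne_self i (s := 1 + t) (by omega) (by omega) ?_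
        push_cast
        linear_combination -h
      exact absurd (hdown _ a_lt_b) (not_lt_a _ j)
    | b j =>
      refine absurd (congrArg b (neg_injective ?_)) hne.symm
      refine eq_of_forall_exists_add_eq hn fun t ht => ?_
      have not_a_le_b : ¬ (a (j - t) : Crown n k) ≤ b i := fun h =>
        not_a_le_b_iff.2 ⟨t, ht, by ring⟩ (a_lt_b_iff.1 (hdown _ (a_lt_b_iff.2 h)))
      obtain ⟨s, hs, h⟩ := not_a_le_b_iff.1 not_a_le_b
      exact ⟨s, hs, by linear_combination h⟩

section UpperBound

variable [NeZero (n + k)]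

open Classical in
/-- The indices `x` of the minimal elements `a x` lying below some `b j` with `j ∈ J`. -/
noncomputable def below (J : Finset (ZMod (n + k))) : Finset (ZMod (n + k)) :=
  {x | ∃ j ∈ J, (a x : Crown n k) ≤ b j}

theorem mem_below {J : Finset (ZMod (n + k))} {x : ZMod (n + k)} :
    x ∈ below J ↔ ∃ j ∈ J, (a x : Crown n k) ≤ b j := by
  simp [below]

theorem nonempty_of_mem_below {J : Finset (ZMod (n + k))} {x : ZMod (n + k)} (hx : x ∈ below J) :
    J.Nonempty := by
  obtain ⟨j, hj, -⟩ := mem_below.1 hx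
  exact ⟨j, hj⟩

theorem below_eq_iterate_thicken (hn : 2 ≤ n) (J : Finset (ZMod (n + k))) :
    below J = (thicken (· + 1))^[n - 2] (J.image (· + 1)) := by
  ext x
  rw [mem_below, mem_iterate_thicken]
  simp only [a_le_b_iff_exists hn, iterate_add_one, exists_mem_image]
  grind

theorem card_add_mul_card_exits_below_le (hn : 2 ≤ n) (J : Finset (ZMod (n + k))) :
    #J + (n - 2) * #(exits (· + 1) (below J)) ≤ #(below J) := by
  rw [below_eq_iterate_thicken hn, ← card_image_of_injective J (add_left_injective 1)]
  exact card_add_mul_card_exits_le (add_left_injective 1) _ _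

theorem below_nonempty (hn : 2 ≤ n) {J : Finset (ZMod (n + k))} (hJ : J.Nonempty) :
    (below J).Nonempty := by
  obtain ⟨j, hj⟩ := hJ
  exact ⟨j + 1, mem_below.2 ⟨j, hj, (a_le_b_iff_exists hn).2 ⟨0, by simp⟩⟩⟩

section Family

variable {J : ZMod (n + k) → Finset (ZMod (n + k))}

theorem exists_card_lt_sum_card_exits_or_exists_notMem (hn : 2 ≤ n)
    (hasymm : ∀ x i, x ∈ below (J i) → i ∉ below (J x)) {C : Finset (ZMod (n + k))}
    (hC : C.Nonempty) (hcyc : ∀ i ∈ C, ∃ x ∈ C, x ∈ below (J i)) {A : Finset (ZMod (n + k))}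
    (hA : ∀ i, i ∈ A ↔ (J i).Nonempty) :
    #A < ∑ i ∈ A, #(exits (· + 1) (below (J i))) ∨
      #A ≤ ∑ i ∈ A, #(exits (· + 1) (below (J i))) ∧ ∀ z, ∃ i ∈ A, z ∉ below (J i) := by
  have one_le_card_exits : ∀ i ∈ A, 1 ≤ #(exits (· + 1) (below (J i))) := fun i hi =>
    (exits_nonempty (below_nonempty hn ((hA i).1 hi)) fun h => hasymm i i h h).card_pos
  have hCA : C ⊆ A := fun i hi => by
    obtain ⟨x, -, hx⟩ := hcyc i hi
    exact (hA i).2 (nonempty_of_mem_below hx)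
  simp only [card_eq_sum_ones A]
  by_cases harc : ∀ i ∈ A, #(exits (· + 1) (below (J i))) ≤ 1
  · refine .inr ⟨sum_le_sum one_le_card_exits, fun z => ?_⟩
    obtain ⟨i, hi, hz⟩ := exists_notMem_of_card_exits_le_one hC (fun i hi => harc i (hCA hi))
      hasymm hcyc z
    exact ⟨i, hCA hi, hz⟩
  · push Not at harc
    exact .inl (sum_lt_sum one_le_card_exits harc)

/-- The two alternatives give the bounds `s * (2 * k + 3 - s) - 2 * (n - 2)` and
`s * (2 * k + 5 - s) - 2 * (n + k)` on twice the sum, where `s` is the number of nonempty `J i`. -/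
theorem two_mul_sum_card_add_le (hn : 2 ≤ n)
    (hasymm : ∀ x i, x ∈ below (J i) → i ∉ below (J x)) {C : Finset (ZMod (n + k))}
    (hC : C.Nonempty) (hcyc : ∀ i ∈ C, ∃ x ∈ C, x ∈ below (J i)) :
    2 * ∑ i, #(J i) + 2 * n ≤ (k + 1) * (k + 2) + 4 := by
  let A : Finset (ZMod (n + k)) := {i | (J i).Nonempty}
  have sum_eq : ∑ i, #(J i) = ∑ i ∈ A, #(J i) := by
    refine (sum_subset A.subset_univ fun i _ hi => ?_).symm
    simpa [A] using hi
  have sum_card_le : ∑ i ∈ A, #(J i) + (n - 2) * ∑ i ∈ A, #(exits (· + 1) (below (J i))) ≤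
      ∑ i ∈ A, #(below (J i)) := by
    rw [mul_sum, ← sum_add_distrib]
    exact sum_le_sum fun i _ => card_add_mul_card_exits_below_le hn (J i)
  have sum_inside := two_mul_sum_card_add_card_le A hasymm
  have card_add_compl : #A + #Aᶜ = n + k := by rw [card_add_card_compl, ZMod.card]
  obtain ⟨m, rfl⟩ := Nat.exists_eq_add_of_le' hn
  rw [sum_eq]
  rw [Nat.add_sub_cancel] at sum_card_le
  obtain hE | ⟨hE, hz⟩ :=
    exists_card_lt_sum_card_exits_or_exists_notMem hn hasymm hC hcyc (A := A) (by simp [A])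
  · have sum_outside := sum_card_sdiff_le A fun i => below (J i)
    have hmE := Nat.mul_le_mul_left m hE
    zify at *
    linear_combination 2 * sum_card_le + sum_inside + 2 * sum_outside + 2 * hmE
      + (2 * #A : ℤ) * card_add_compl + Int.le_self_sq (#A - (k + 1))
  · have sum_outside := sum_card_sdiff_add_card_compl_le (B := fun i => below (J i)) fun z _ => hz z
    have hmE := Nat.mul_le_mul_left m hE
    zify at *
    linear_combination 2 * sum_card_le + sum_inside + 2 * sum_outside + 2 * hmE
      + (2 * #A - 2 : ℤ) * card_add_compl + Int.le_self_sq (#A - (k + 2))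

end Family

open Classical in
/-- The row of index `i`, when a set of critical pairs `(a i, b j)` is drawn as a set of cells
`(i, j)`. -/
noncomputable def row (S : Finset (Crit (Crown n k))) (i : ZMod (n + k)) :
    Finset (ZMod (n + k)) :=
  {j | ∃ p ∈ S, p.1 = (a i, b j)}

variable {S : Finset (Crit (Crown n k))}

theorem mem_row {i j : ZMod (n + k)} : j ∈ row S i ↔ ∃ p ∈ S, p.1 = (a i, b j) := by
  simp [row]

theorem sum_card_row (hn : 2 ≤ n) (S : Finset (Crit (Crown n k))) : ∑ i, #(row S i) = #S := by
  classical
  have image_eq : (univ.sigma (row S)).image (fun c => ((a c.1, b c.2) : Crown n k × Crown n k)) =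
      S.image Subtype.val := by
    ext p
    simp only [mem_image, mem_sigma, mem_univ, true_and, mem_row]
    constructor
    · rintro ⟨c, ⟨q, hq, hqc⟩, rfl⟩
      exact ⟨q, hq, hqc⟩
    · rintro ⟨q, hq, rfl⟩
      obtain ⟨i, j, hij⟩ := exists_eq_of_mem_crit hn q.2
      exact ⟨⟨i, j⟩, ⟨q, hq, hij⟩, hij.symm⟩
  rw [← card_sigma, ← card_image_of_injective S Subtype.val_injective, ← image_eq,
    card_image_of_injective]
  rintro ⟨i, j⟩ ⟨i', j'⟩ h
  simp_all

theorem notMem_below_row (hS : (critGraph (Crown n k)).IsIndepSet (S : Set (Crit (Crown n k))))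
    (x i : ZMod (n + k)) (hx : x ∈ below (row S i)) : i ∉ below (row S x) := by
  intro hi
  obtain ⟨j, hj, hxj⟩ := mem_below.1 hx
  obtain ⟨l, hl, hil⟩ := mem_below.1 hi
  obtain ⟨p, hp, hpij⟩ := mem_row.1 hj
  obtain ⟨q, hq, hqxl⟩ := mem_row.1 hl
  refine isIndepSet_critGraph_iff.1 hS p hp q hq ?_ ?_ <;> simpa [Precedes, hpij, hqxl]

theorem exists_forall_exists_mem_below_row (hn : 2 ≤ n)
    (hS : ¬ CritReversible (S : Set (Crit (Crown n k)))) :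
    ∃ C : Finset (ZMod (n + k)), C.Nonempty ∧ ∀ i ∈ C, ∃ x ∈ C, x ∈ below (row S i) := by
  classical
  rw [critReversible_iff_wellFoundedOn, Set.WellFoundedOn, WellFounded.wellFounded_iff_has_min]
    at hS
  push Not at hS
  obtain ⟨T, ⟨p, hp⟩, hT⟩ := hS
  refine ⟨univ.filter fun i => ∃ p ∈ T, ∃ j, p.1.1 = (a i, b j), ?_, fun i hi => ?_⟩
  · obtain ⟨i, j, hij⟩ := exists_eq_of_mem_crit hn p.1.2
    exact ⟨i, mem_filter_univ _ |>.2 ⟨p, hp, j, hij⟩⟩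
  · obtain ⟨p, hp, j, hij⟩ := mem_filter_univ _ |>.1 hi
    obtain ⟨q, hq, hqp⟩ := hT p hp
    obtain ⟨x, l, hxl⟩ := exists_eq_of_mem_crit hn q.1.2
    refine ⟨x, mem_filter_univ _ |>.2 ⟨q, hq, l, hxl⟩, mem_below.2 ⟨j, ?_, ?_⟩⟩
    · exact mem_row.2 ⟨p.1, p.2, hij⟩
    · have hqp : q.1.1.1 ≤ p.1.1.2 := hqp
      rwa [hij, hxl] at hqp

end UpperBound

theorem two_mul_card_add_le_of_isIndepSet (hn : 2 ≤ n) {S : Finset (Crit (Crown n k))}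
    (hindep : (critGraph (Crown n k)).IsIndepSet (S : Set (Crit (Crown n k))))
    (hS : ¬ CritReversible (S : Set (Crit (Crown n k)))) :
    2 * #S + 2 * n ≤ (k + 1) * (k + 2) + 4 := by
  have : NeZero (n + k) := ⟨by omega⟩
  obtain ⟨C, hC, hcyc⟩ := exists_forall_exists_mem_below_row hn hS
  rw [← sum_card_row hn]
  exact two_mul_sum_card_add_le hn (notMem_below_row hindep) hC hcyc

section Extremal

variable {i j : ℕ}

/-- Cells `(i, j)`, standing for the critical pairs `(a i, b j)`, of an extremal independent set.
The cells with `n - 1 ≤ j ≤ k` and `i ≤ j`, or with `k < j < i + k + 1` and `i < n`, form a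
reversible set of size `(k + 1) * (k + 2) / 2`. Adding `(n, 0)` to it costs the `n - 1` cells
`(i, n - 1)` with `0 < i < n`, and creates the alternating cycle `(1, k + 1)`, `(n, 0)`,
`(0, n - 1)`. -/
def extremalCells (n k : ℕ) : Finset (ℕ × ℕ) :=
  {(0, n - 1), (n, 0)} ∪
    (((Ico n (k + 1)).sigma fun j => range (j + 1)).image (fun c => (c.2, c.1)) ∪
      ((range n).sigma range).image fun c => (c.1, k + 1 + c.2))

theorem mem_extremalCells : (i, j) ∈ extremalCells n k ↔ (i = 0 ∧ j = n - 1) ∨ (i = n ∧ j = 0) ∨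
    (n ≤ j ∧ j ≤ k ∧ i ≤ j) ∨ (k < j ∧ j < i + (k + 1) ∧ i < n) := by
  simp only [extremalCells, mem_union, mem_insert, mem_singleton, mem_image, mem_sigma, mem_Ico,
    mem_range, Prod.mk.injEq, Sigma.exists]
  constructor
  · rintro ((h | h) | ⟨x, y, h⟩ | ⟨x, y, h⟩) <;> omega
  · rintro (h | h | h | h)
    · exact .inl (.inl h)
    · exact .inl (.inr h)
    · exact .inr (.inl ⟨j, i, by omega⟩)
    · exact .inr (.inr ⟨i, j - (k + 1), by omega⟩)

theorem two_mul_card_extremalCells (hn : 2 ≤ n) (hnk : n ≤ k + 1) :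
    2 * #(extremalCells n k) + 2 * n = (k + 1) * (k + 2) + 4 := by
  have card_eq : #(extremalCells n k) = 2 + (∑ j ∈ Ico n (k + 1), (j + 1) + ∑ i ∈ range n, i) := by
    rw [extremalCells, card_union_of_disjoint, card_union_of_disjoint, card_pair,
      card_image_of_injOn, card_image_of_injOn, card_sigma, card_sigma]
    · simp only [card_range]
    · rintro ⟨x, y⟩ - ⟨x', y'⟩ -
      grind
    · rintro ⟨x, y⟩ - ⟨x', y'⟩ -
      grind
    · grind
    · rw [disjoint_left]
      grind
    · rw [disjoint_left]
      grind
  have sum_eq : ∑ j ∈ Ico n (k + 1), (j + 1) + (∑ i ∈ range n, i + n) = ∑ i ∈ range (k + 2), i := by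
    rw [sum_Ico_add' (fun j => j), ← sum_range_succ, add_comm, sum_range_add_sum_Ico _ (by omega)]
  have := sum_range_id_mul_two (k + 2)
  rw [show k + 2 - 1 = k + 1 from rfl] at this
  lia

theorem lt_of_mem_extremalCells (hn : 2 ≤ n) (hnk : n ≤ k + 1) (h : (i, j) ∈ extremalCells n k) :
    i < n + k ∧ j < n + k := by
  rw [mem_extremalCells] at h
  omega

theorem not_a_le_b_of_mem_extremalCells (hn : 2 ≤ n) (hnk : n ≤ k + 1)
    (h : (i, j) ∈ extremalCells n k) : ¬ (a i : Crown n k) ≤ b j := by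
  obtain ⟨hi, hj⟩ := lt_of_mem_extremalCells hn hnk h
  rw [natCast_a_le_b_iff hi hj]
  rw [mem_extremalCells] at h
  omega

theorem not_a_le_b_of_a_le_b_of_mem_extremalCells (hn : 2 ≤ n) (hnk : n ≤ k + 1) {i' j' : ℕ}
    (h : (i, j) ∈ extremalCells n k) (h' : (i', j') ∈ extremalCells n k)
    (hle : (a i : Crown n k) ≤ b j') : ¬ (a i' : Crown n k) ≤ b j := by
  obtain ⟨hi, hj⟩ := lt_of_mem_extremalCells hn hnk h
  obtain ⟨hi', hj'⟩ := lt_of_mem_extremalCells hn hnk h'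
  rw [natCast_a_le_b_iff hi hj'] at hle
  rw [natCast_a_le_b_iff hi' hj]
  rw [mem_extremalCells] at h h'
  omega

open Classical in
/-- The critical pairs `(a i, b j)` given by the cells `(i, j)` of `extremalCells n k`. -/
noncomputable def extremalSet (n k : ℕ) : Finset (Crit (Crown n k)) :=
  ((extremalCells n k).image fun c => ((a c.1, b c.2) : Crown n k × Crown n k)).subtype
    (· ∈ Crit (Crown n k))

theorem mem_extremalSet {p : Crit (Crown n k)} :
    p ∈ extremalSet n k ↔ ∃ i j : ℕ, (i, j) ∈ extremalCells n k ∧ (a i, b j) = p.1 := by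
  simp [extremalSet]

theorem card_extremalSet (hn : 2 ≤ n) (hnk : n ≤ k + 1) :
    #(extremalSet n k) = #(extremalCells n k) := by
  classical
  rw [extremalSet, card_subtype, filter_true_of_mem, card_image_of_injOn]
  · rintro ⟨i, j⟩ h ⟨i', j'⟩ h' heq
    obtain ⟨hi, hj⟩ := lt_of_mem_extremalCells hn hnk h
    obtain ⟨hi', hj'⟩ := lt_of_mem_extremalCells hn hnk h'
    simpa [ZMod.natCast_eq_natCast_iff', Nat.mod_eq_of_lt, hi, hj, hi', hj'] using heq
  · simp only [mem_image]
    rintro _ ⟨⟨i, j⟩, h, rfl⟩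
    exact mem_crit_of_not_le (not_a_le_b_of_mem_extremalCells hn hnk h)

theorem isIndepSet_extremalSet (hn : 2 ≤ n) (hnk : n ≤ k + 1) :
    (critGraph (Crown n k)).IsIndepSet (extremalSet n k : Set (Crit (Crown n k))) := by
  have : NeZero (n + k) := ⟨by omega⟩
  refine isIndepSet_critGraph_iff.2 fun p hp q hq hpq hqp => ?_
  obtain ⟨i, j, hij, hp⟩ := mem_extremalSet.1 hp
  obtain ⟨i', j', hij', hq⟩ := mem_extremalSet.1 hq
  rw [Precedes, ← hp, ← hq] at hpq hqp
  exact not_a_le_b_of_a_le_b_of_mem_extremalCells hn hnk hij hij' hpq hqp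

theorem not_critReversible_extremalSet (hn : 2 ≤ n) (hnk : n ≤ k + 1) :
    ¬ CritReversible (extremalSet n k : Set (Crit (Crown n k))) := by
  have exists_pair {i j : ℕ} (h : (i, j) ∈ extremalCells n k) :
      ∃ p : (extremalSet n k : Set (Crit (Crown n k))), p.1.1 = (a i, b j) :=
    ⟨⟨⟨_, mem_crit_of_not_le (not_a_le_b_of_mem_extremalCells hn hnk h)⟩,
      mem_extremalSet.2 ⟨i, j, h, rfl⟩⟩, rfl⟩
  obtain ⟨p, hp⟩ := exists_pair (mem_extremalCells.2 (.inl ⟨rfl, rfl⟩))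
  obtain ⟨q, hq⟩ := exists_pair (mem_extremalCells.2 (.inr (.inl ⟨rfl, rfl⟩)))
  obtain ⟨r, hr⟩ := exists_pair (i := 1) (j := k + 1) (mem_extremalCells.2 (by omega))
  have precedes {p q : (extremalSet n k : Set (Crit (Crown n k)))} {i j i' j' : ℕ}
      (hp : p.1.1 = (a i, b j)) (hq : q.1.1 = (a i', b j')) (hi : i < n + k) (hj' : j' < n + k)
      (h : (j' < i ∧ i < j' + n) ∨ i + k < j') : Precedes p.1.1 q.1.1 := by
    rw [Precedes, hp, hq]
    exact (natCast_a_le_b_iff hi hj').2 h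
  have : NeZero (n + k) := ⟨by omega⟩
  exact fun h => (critReversible_iff_wellFoundedOn.1 h).asymmetric₃ _ _ _
    (precedes hp hr (by omega) (by omega) (by omega))
    (precedes hr hq (by omega) (by omega) (by omega))
    (precedes hq hp (by omega) (by omega) (by omega))

end Extremal

end Crown

theorem theorem1p5_general (n k : ℕ) (hn : 2 ≤ n) :
    (∀ S : Finset (Crit (Crown n k)),
      (critGraph (Crown n k)).IsIndepSet (S : Set (Crit (Crown n k))) →
      ¬ CritReversible (S : Set (Crit (Crown n k))) →
      (S.card : ℚ) ≤ ((k : ℚ) + 1) * ((k : ℚ) + 2) / 2 + 2 - (n : ℚ)) ∧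
    (n ≤ k + 1 → ∃ S : Finset (Crit (Crown n k)),
      (critGraph (Crown n k)).IsIndepSet (S : Set (Crit (Crown n k))) ∧
      ¬ CritReversible (S : Set (Crit (Crown n k))) ∧
      (S.card : ℚ) = ((k : ℚ) + 1) * ((k : ℚ) + 2) / 2 + 2 - (n : ℚ)) := by
  refine ⟨fun S hindep hS => ?_, fun hnk => ?_⟩
  · have := Crown.two_mul_card_add_le_of_isIndepSet hn hindep hS
    qify at this
    linarith
  · refine ⟨Crown.extremalSet n k, Crown.isIndepSet_extremalSet hn hnk,
      Crown.not_critReversible_extremalSet hn hnk, ?_⟩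
    have := Crown.two_mul_card_extremalCells hn hnk
    rw [← Crown.card_extremalSet hn hnk] at this
    qify at this
    linarith

theorem theorem1p5 (n k : ℕ) (hn : 3 ≤ n) (hnk : n ≤ k) :
    (∀ S : Finset (Crit (Crown n k)),
      (critGraph (Crown n k)).IsIndepSet (S : Set (Crit (Crown n k))) →
      ¬ CritReversible (S : Set (Crit (Crown n k))) →
      (S.card : ℚ) ≤ ((k : ℚ) + 1) * ((k : ℚ) + 2) / 2 + 2 - (n : ℚ)) ∧
    (∃ S : Finset (Crit (Crown n k)),
      (critGraph (Crown n k)).IsIndepSet (S : Set (Crit (Crown n k))) ∧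
      ¬ CritReversible (S : Set (Crit (Crown n k))) ∧
      (S.card : ℚ) = ((k : ℚ) + 1) * ((k : ℚ) + 2) / 2 + 2 - (n : ℚ)) := by
  obtain ⟨card_le, exists_card_eq⟩ := theorem1p5_general n k (by omega)
  exact ⟨card_le, exists_card_eq (by omega)⟩
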